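/- Let $\Omega\subset\mathbb R^2$ be a bounded domain (non-empty, open, connected) with smooth boundary, let $\omega$ be a non-zero real constant, and let all functions be complex-valued. For every $f\in L^2(\Omega)$ the Dirichlet problem $$\Delta u - i\omega u = f \ \text{ in } \Omega,\qquad u = 0 \ \text{ on } \partial\Omega,$$ has a unique weak solution $u\in H^1_0(\Omega)$, that is, there is exactly one $u\in H^1_0(\Omega)$ with $$-\int_\Omega \nabla u\cdot\overline{\nabla v}\,dx - i\omega\int_\Omega u\,\overline v\,dx=\int_\Omega f\,\overline v\,dx\qquad\text{for all } v\in H^1_0(\Omega).$$ Here $H^1_0(\Omega)$ is the closure of $C_c^\infty(\Omega)$ in $H^1(\Omega)$, and $\|u\|_{H^1(\Omega)}^2=\|u\|_{L^2(\Omega)}^2+\|\nabla u\|_{L^2(\Omega)}^2$. Moreover, the solution depends continuously on $f$: there is a constant $C$, depending only on $\Omega$ and $\omega$, such that the solutions $u_1,u_2$ for any right-hand sides $f_1,f_2\in L^2(\Omega)$ satisfy $$\|u_1-u_2\|_{H^1(\Omega)}\le C\,\|f_1-f_2\|_{L^2(\Omega)}.$$ -/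

import Mathlib

open MeasureTheory TopologicalSpace
open scoped Distributions ComplexConjugate

noncomputable section

/-- The plane `ℝ²` with its Euclidean structure. -/
abbrev Plane : Type := EuclideanSpace ℝ (Fin 2)

/-- The `i`-th partial derivative at `x` of a differentiable function `φ : ℝ² → ℂ`. -/
def partialDeriv (i : Fin 2) (φ : Plane → ℂ) (x : Plane) : ℂ :=
  fderiv ℝ φ x (EuclideanSpace.single i 1)

/-- An open set `Ω ⊆ ℝ²` has smooth boundary if, near every boundary point `p`, it is the
sublevel set `{ρ < 0}` of a smooth real function `ρ` whose differential does not vanish at `p`. -/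
def HasSmoothBoundary (Ω : Opens Plane) : Prop :=
  ∀ p ∈ frontier (Ω : Set Plane), ∃ U : Set Plane, IsOpen U ∧ p ∈ U ∧
    ∃ ρ : Plane → ℝ, ContDiffOn ℝ ((⊤ : ℕ∞) : WithTop ℕ∞) ρ U ∧ fderiv ℝ ρ p ≠ 0 ∧
      ∀ x ∈ U, x ∈ Ω ↔ ρ x < 0

/-- The complex Hilbert space `L²(Ω) = L²(Ω; ℂ)`. -/
abbrev L2 (Ω : Opens Plane) : Type := Lp ℂ 2 (volume.restrict (Ω : Set Plane))

/-- The complex Hilbert space `L²(Ω; ℂ²)` of square-integrable vector fields on `Ω`. -/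
abbrev L2Vec (Ω : Opens Plane) : Type :=
  Lp (EuclideanSpace ℂ (Fin 2)) 2 (volume.restrict (Ω : Set Plane))

/-- `G` is the weak (distributional) gradient of `u` on `Ω`:
`∫_Ω u ∂ᵢφ = - ∫_Ω Gᵢ φ` for all test functions `φ ∈ C_c^∞(Ω)` and `i = 1, 2`. -/
def IsWeakGradient {Ω : Opens Plane} (u : L2 Ω) (G : L2Vec Ω) : Prop :=
  ∀ (φ : 𝓓(Ω, ℂ)) (i : Fin 2),
    ∫ x in (Ω : Set Plane), u x * partialDeriv i φ x = - ∫ x in (Ω : Set Plane), G x i * φ x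

theorem memLp_testFunction {Ω : Opens Plane} (φ : 𝓓(Ω, ℂ)) :
    MemLp φ 2 (volume.restrict (Ω : Set Plane)) :=
  φ.continuous.memLp_of_hasCompactSupport φ.hasCompactSupport

theorem memLp_partialDeriv {Ω : Opens Plane} (φ : 𝓓(Ω, ℂ)) (i : Fin 2) :
    MemLp (partialDeriv i φ) 2 (volume.restrict (Ω : Set Plane)) := by
  refine Continuous.memLp_of_hasCompactSupport (f := partialDeriv i φ) ?_ ?_
  · exact (φ.contDiff.continuous_fderiv (by simp)).clm_apply continuous_const
  · exact φ.hasCompactSupport.fderiv_apply ℝ _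

theorem memLp_component {Ω : Opens Plane} (G : L2Vec Ω) (i : Fin 2) :
    MemLp (fun x => G x i) 2 (volume.restrict (Ω : Set Plane)) :=
  (Lp.memLp G).continuousLinearMap_comp (EuclideanSpace.proj (𝕜 := ℂ) i)

theorem isWeakGradient_zero (Ω : Opens Plane) : IsWeakGradient (0 : L2 Ω) (0 : L2Vec Ω) := by
  intro φ i
  have h1 : ∫ x in (Ω : Set Plane), (0 : L2 Ω) x * partialDeriv i φ x = 0 := by
    refine integral_eq_zero_of_ae ?_
    filter_upwards [Lp.coeFn_zero ℂ 2 (volume.restrict (Ω : Set Plane))] with x hx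
    rw [hx]
    simp
  have h2 : ∫ x in (Ω : Set Plane), (0 : L2Vec Ω) x i * φ x = 0 := by
    refine integral_eq_zero_of_ae ?_
    filter_upwards [Lp.coeFn_zero (EuclideanSpace ℂ (Fin 2)) 2
      (volume.restrict (Ω : Set Plane))] with x hx
    rw [hx]
    simp
  rw [h1, h2, neg_zero]

theorem IsWeakGradient.add {Ω : Opens Plane} {u v : L2 Ω} {G H : L2Vec Ω}
    (hu : IsWeakGradient u G) (hv : IsWeakGradient v H) : IsWeakGradient (u + v) (G + H) := by
  intro φ i
  have h1 : ∫ x in (Ω : Set Plane), (u + v) x * partialDeriv i φ x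
      = (∫ x in (Ω : Set Plane), u x * partialDeriv i φ x)
        + ∫ x in (Ω : Set Plane), v x * partialDeriv i φ x := by
    refine Eq.trans ?_ (integral_add ((Lp.memLp u).integrable_mul (memLp_partialDeriv φ i))
      ((Lp.memLp v).integrable_mul (memLp_partialDeriv φ i)))
    apply integral_congr_ae
    filter_upwards [Lp.coeFn_add u v] with x hx
    rw [hx]
    simp [add_mul]
  have h2 : ∫ x in (Ω : Set Plane), (G + H) x i * φ x
      = (∫ x in (Ω : Set Plane), G x i * φ x) + ∫ x in (Ω : Set Plane), H x i * φ x := by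
    refine Eq.trans ?_ (integral_add ((memLp_component G i).integrable_mul (memLp_testFunction φ))
      ((memLp_component H i).integrable_mul (memLp_testFunction φ)))
    apply integral_congr_ae
    filter_upwards [Lp.coeFn_add G H] with x hx
    rw [hx]
    simp [add_mul]
  rw [h1, h2, hu φ i, hv φ i, neg_add]

theorem IsWeakGradient.smul {Ω : Opens Plane} {u : L2 Ω} {G : L2Vec Ω} (c : ℂ)
    (hu : IsWeakGradient u G) : IsWeakGradient (c • u) (c • G) := by
  intro φ i
  have h1 : ∫ x in (Ω : Set Plane), (c • u) x * partialDeriv i φ x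
      = c * ∫ x in (Ω : Set Plane), u x * partialDeriv i φ x := by
    rw [← integral_const_mul]
    apply integral_congr_ae
    filter_upwards [Lp.coeFn_smul c u] with x hx
    rw [hx]
    simp [mul_assoc]
  have h2 : ∫ x in (Ω : Set Plane), (c • G) x i * φ x
      = c * ∫ x in (Ω : Set Plane), G x i * φ x := by
    rw [← integral_const_mul]
    apply integral_congr_ae
    filter_upwards [Lp.coeFn_smul c G] with x hx
    rw [hx]
    simp [mul_assoc]
  rw [h1, h2, hu φ i, mul_neg]

/-- The Sobolev space `H¹(Ω)` of functions in `L²(Ω)` with weak gradient in `L²(Ω; ℂ²)`. An element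
is stored as the pair `(u, ∇u)`, so that the norm is
`‖u‖_{H¹} = (‖u‖²_{L²} + ‖∇u‖²_{L²})^{1/2}`. -/
def H1 (Ω : Opens Plane) : Submodule ℂ (WithLp 2 (L2 Ω × L2Vec Ω)) where
  carrier := {w | IsWeakGradient w.fst w.snd}
  zero_mem' := isWeakGradient_zero Ω
  add_mem' := fun hv hw => IsWeakGradient.add hv hw
  smul_mem' := fun c _ hw => IsWeakGradient.smul c hw

/-- The function underlying an element of `H¹(Ω)`. -/
def H1.fn {Ω : Opens Plane} (u : H1 Ω) : L2 Ω := (u : WithLp 2 (L2 Ω × L2Vec Ω)).fst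

/-- The weak gradient of an element of `H¹(Ω)`. -/
def H1.grad {Ω : Opens Plane} (u : H1 Ω) : L2Vec Ω := (u : WithLp 2 (L2 Ω × L2Vec Ω)).snd

/-- The elements of `H¹(Ω)` that are (almost everywhere equal to) test functions
`φ ∈ C_c^∞(Ω)`. -/
def testSubspace (Ω : Opens Plane) : Submodule ℂ (H1 Ω) where
  carrier := {u | ∃ φ : 𝓓(Ω, ℂ), H1.fn u =ᵐ[volume.restrict (Ω : Set Plane)] φ}
  zero_mem' := ⟨0, Lp.coeFn_zero ℂ 2 (volume.restrict (Ω : Set Plane))⟩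
  add_mem' := by
    rintro u v ⟨φ, hφ⟩ ⟨ψ, hψ⟩
    exact ⟨φ + ψ, (Lp.coeFn_add (H1.fn u) (H1.fn v)).trans (hφ.add hψ)⟩
  smul_mem' := by
    rintro c u ⟨φ, hφ⟩
    exact ⟨c • φ, (Lp.coeFn_smul c (H1.fn u)).trans (hφ.const_smul c)⟩

/-- The Sobolev space `H¹₀(Ω)`: the closure of `C_c^∞(Ω)` in `H¹(Ω)`, with the norm of `H¹(Ω)`. -/
def H10 (Ω : Opens Plane) : Submodule ℂ (H1 Ω) := (testSubspace Ω).topologicalClosure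

/-- `u ∈ H¹₀(Ω)` is a weak solution of `Δu - iωu = f` in `Ω`, `u = 0` on `∂Ω`:
`- ∫_Ω ∇u · conj ∇v - iω ∫_Ω u conj v = ∫_Ω f conj v` for all `v ∈ H¹₀(Ω)`. -/
def IsWeakSolution {Ω : Opens Plane} (ω : ℝ) (f : L2 Ω) (u : H10 Ω) : Prop :=
  ∀ v : H10 Ω,
    - (∫ x in (Ω : Set Plane), ∑ i, H1.grad (u : H1 Ω) x i * conj (H1.grad (v : H1 Ω) x i))
      - Complex.I * ω * (∫ x in (Ω : Set Plane), H1.fn (u : H1 Ω) x * conj (H1.fn (v : H1 Ω) x))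
      = ∫ x in (Ω : Set Plane), f x * conj (H1.fn (v : H1 Ω) x)

end

/-!
The weak formulation is turned into an operator equation on the Hilbert space `V = H¹₀(Ω)`. Let
`J : V → L²(Ω)` be the inclusion and `K = J* J`, a bounded self-adjoint operator on `V`. Since the
inner product of `V` is `⟪v, u⟫ = ⟪J v, J u⟫ + ⟪∇v, ∇u⟫`, the function `u` is a weak solution with
right-hand side `f` exactly when `(1 - iω) K u - u = J* f` (`isWeakSolution_iff` is this equation
tested against `v ∈ V`).

Dividing by `1 - iω ≠ 0`, the operator on the left is a multiple of `K - (1 - iω)⁻¹`, and the number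
`(1 - iω)⁻¹` is not real as `ω ≠ 0`. The spectrum of a self-adjoint operator is real, so the
operator is invertible (`isUnit_smul_sub_one`). This gives existence and uniqueness, and the
solution operator, the inverse composed with `J*`, is bounded and linear, which gives continuous
dependence (`exists_solutionOperator`). No Poincaré inequality is
needed, because the term `iω u` controls the `L²` norm.

The completeness of `V`, on which adjoints and the spectral theory rest, holds because being a weak
gradient is a closed condition (`isClosed_H1`).
-/

open scoped InnerProductSpace

theorem continuous_integral_mul {α : Type*} [MeasurableSpace α] {μ : Measure α} {ψ : α → ℂ}
    (hψ : MemLp ψ 2 μ) : Continuous fun u : Lp ℂ 2 μ => ∫ x, u x * ψ x ∂μ := by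
  have h (u : Lp ℂ 2 μ) : ∫ x, u x * ψ x ∂μ = ⟪hψ.star.toLp (star ψ), u⟫_ℂ := by
    rw [L2.inner_def]
    refine integral_congr_ae ?_
    filter_upwards [hψ.star.coeFn_toLp] with x hx
    rw [hx]
    simp
  simp_rw [h]
  fun_prop

theorem continuous_integral_component_mul {Ω : Opens Plane} {ψ : Plane → ℂ}
    (hψ : MemLp ψ 2 (volume.restrict (Ω : Set Plane))) (i : Fin 2) :
    Continuous fun G : L2Vec Ω => ∫ x in (Ω : Set Plane), G x i * ψ x := by
  let P : EuclideanSpace ℂ (Fin 2) →L[ℂ] ℂ := EuclideanSpace.proj i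
  have h (G : L2Vec Ω) : ∫ x in (Ω : Set Plane), G x i * ψ x
      = ∫ x in (Ω : Set Plane), (P.compLpL 2 _ G) x * ψ x := by
    refine integral_congr_ae ?_
    filter_upwards [P.coeFn_compLpL G] with x hx
    rw [hx]
    rfl
  simp_rw [h]
  exact (continuous_integral_mul hψ).comp (P.compLpL 2 _).continuous

theorem isClosed_H1 (Ω : Opens Plane) :
    IsClosed (H1 Ω : Set (WithLp 2 (L2 Ω × L2Vec Ω))) := by
  change IsClosed {w : WithLp 2 (L2 Ω × L2Vec Ω) | IsWeakGradient w.fst w.snd}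
  simp only [IsWeakGradient, Set.ofPred_forall]
  refine isClosed_iInter fun φ => isClosed_iInter fun i => isClosed_eq ?_ ?_
  · exact (continuous_integral_mul (memLp_partialDeriv φ i)).comp
      (WithLp.fstL 2 ℂ (L2 Ω) (L2Vec Ω)).continuous
  · exact ((continuous_integral_component_mul (memLp_testFunction φ) i).comp
      (WithLp.sndL 2 ℂ (L2 Ω) (L2Vec Ω)).continuous).neg

instance completeSpace_H1 (Ω : Opens Plane) : CompleteSpace (H1 Ω) :=
  (isClosed_H1 Ω).completeSpace_coe

instance completeSpace_H10 (Ω : Opens Plane) : CompleteSpace (H10 Ω) :=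
  (testSubspace Ω).isClosed_topologicalClosure.completeSpace_coe

/-- The quotient by `1 - iω` is `K - (1 - iω)⁻¹`, and `(1 - iω)⁻¹` is not real. -/
theorem isUnit_smul_sub_one {A : Type*} [CStarAlgebra A] {K : A} (hK : IsSelfAdjoint K)
    {ω : ℝ} (hω : ω ≠ 0) : IsUnit ((1 - Complex.I * ω) • K - 1) := by
  set z : ℂ := 1 - Complex.I * ω with hz
  have him : z.im = -ω := by simp [hz]
  have hz0 : z ≠ 0 := fun h => hω (by simpa [h] using him)
  have hspec : z⁻¹ ∉ spectrum ℂ K := fun h => by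
    have := hK.im_eq_zero_of_mem_spectrum h
    simp [Complex.inv_im, him, hω, hz0] at this
  have hunit := (spectrum.notMem_iff.mp hspec).neg.smul (Units.mk0 z hz0)
  convert hunit using 1
  rw [Units.smul_mk0, neg_sub, smul_sub, Algebra.algebraMap_eq_smul_one, smul_inv_smul₀ hz0]

/-- The equation tested against all `v` says `((1 - iω) J* J - 1) u = J* f`, so `S` is the
inverse of the operator on the left composed with `J*`. -/
theorem exists_solutionOperator {V H : Type*} [NormedAddCommGroup V] [InnerProductSpace ℂ V]
    [CompleteSpace V] [NormedAddCommGroup H] [InnerProductSpace ℂ H] [CompleteSpace H]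
    (J : V →L[ℂ] H) {ω : ℝ} (hω : ω ≠ 0) :
    ∃ S : H → V, (∀ (f : H) (u : V),
      (∀ v : V, (1 - Complex.I * ω) * ⟪J v, J u⟫_ℂ - ⟪v, u⟫_ℂ = ⟪J v, f⟫_ℂ) ↔ u = S f) ∧
        ∃ C : ℝ, ∀ f g : H, ‖S f - S g‖ ≤ C * ‖f - g‖ := by
  obtain ⟨T, hT⟩ := isUnit_smul_sub_one
    (ContinuousLinearMap.isPositive_adjoint_comp_self J).isSelfAdjoint hω
  let S : H →L[ℂ] V := (↑T⁻¹ : V →L[ℂ] V) ∘L J.adjoint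
  refine ⟨S, fun f u => ?_, ‖S‖, fun f g => map_sub S f g ▸ S.le_opNorm (f - g)⟩
  have hweak : (∀ v : V, (1 - Complex.I * ω) * ⟪J v, J u⟫_ℂ - ⟪v, u⟫_ℂ = ⟪J v, f⟫_ℂ) ↔
      (T : V →L[ℂ] V) u = J.adjoint f := by
    rw [ext_iff_inner_left ℂ, hT]
    refine forall_congr' fun v => ?_
    simp [inner_sub_right, inner_smul_right, ContinuousLinearMap.adjoint_inner_right]
  rw [hweak]
  constructor
  · intro h
    change u = (↑T⁻¹ : V →L[ℂ] V) (J.adjoint f)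
    rw [← h, ← mul_apply_eq_comp, T.inv_mul, one_apply_eq_self]
  · rintro rfl
    change (T : V →L[ℂ] V) ((↑T⁻¹ : V →L[ℂ] V) (J.adjoint f)) = J.adjoint f
    rw [← mul_apply_eq_comp, T.mul_inv, one_apply_eq_self]

/-- The inclusion `H¹₀(Ω) → L²(Ω)` as a bounded operator. -/
noncomputable def H10.toL2 (Ω : Opens Plane) : H10 Ω →L[ℂ] L2 Ω :=
  (WithLp.fstL 2 ℂ (L2 Ω) (L2Vec Ω)) ∘L (H1 Ω).subtypeL ∘L (H10 Ω).subtypeL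

theorem H10.inner_eq {Ω : Opens Plane} (v u : H10 Ω) :
    ⟪v, u⟫_ℂ = ⟪H10.toL2 Ω v, H10.toL2 Ω u⟫_ℂ
      + ⟪H1.grad (v : H1 Ω), H1.grad (u : H1 Ω)⟫_ℂ := rfl

theorem isWeakSolution_iff {Ω : Opens Plane} (ω : ℝ) (f : L2 Ω) (u : H10 Ω) :
    IsWeakSolution ω f u ↔ ∀ v : H10 Ω,
      (1 - Complex.I * ω) * ⟪H10.toL2 Ω v, H10.toL2 Ω u⟫_ℂ - ⟪v, u⟫_ℂ
        = ⟪H10.toL2 Ω v, f⟫_ℂ := by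
  refine forall_congr' fun v => ?_
  have hgrad : ∫ x in (Ω : Set Plane),
      ∑ i, H1.grad (u : H1 Ω) x i * conj (H1.grad (v : H1 Ω) x i)
      = ⟪H1.grad (v : H1 Ω), H1.grad (u : H1 Ω)⟫_ℂ := by
    rw [L2.inner_def]
    simp [PiLp.inner_apply]
  have hfn (g : L2 Ω) : ∫ x in (Ω : Set Plane), g x * conj (H1.fn (v : H1 Ω) x)
      = ⟪H10.toL2 Ω v, g⟫_ℂ := by
    rw [L2.inner_def]
    rfl
  have hu : H1.fn (u : H1 Ω) = H10.toL2 Ω u := rfl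
  rw [hgrad, hfn, hfn, hu, H10.inner_eq v u]
  ring_nf

theorem theorem1 (Ω : Opens Plane) (hconn : IsConnected (Ω : Set Plane))
    (hbdd : Bornology.IsBounded (Ω : Set Plane)) (hsmooth : HasSmoothBoundary Ω)
    (ω : ℝ) (hω : ω ≠ 0) :
    (∀ f : L2 Ω, ∃! u : H10 Ω, IsWeakSolution ω f u) ∧
      ∃ C : ℝ, ∀ (f g : L2 Ω) (u v : H10 Ω),
        IsWeakSolution ω f u → IsWeakSolution ω g v → ‖u - v‖ ≤ C * ‖f - g‖ := by
  obtain ⟨S, hS, C, hC⟩ := exists_solutionOperator (V := H10 Ω) (H := L2 Ω) (H10.toL2 Ω) hω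
  have hsol (f : L2 Ω) (u : H10 Ω) : IsWeakSolution ω f u ↔ u = S f :=
    (isWeakSolution_iff ω f u).trans (hS f u)
  refine ⟨fun f => ⟨S f, (hsol f _).mpr rfl, fun u hu => (hsol f u).mp hu⟩, C, ?_⟩
  intro f g u v hu hv
  rw [(hsol f u).mp hu, (hsol g v).mp hv]
  exact hC f g
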